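/- For $r\ge 1$ and $z\in\mathbb C\setminus\{-1,-2,-3,\dots\}$ let $H_z^{(r)}$ be the harmonic number of order $r$ at $z$: $H_z=H_z^{(1)}=\psi(z+1)+\gamma$ and, for $r\ge 2$, $H_z^{(r)}=\zeta(r)+\frac{(-1)^{r-1}}{(r-1)!}\psi^{(r-1)}(z+1)$, where $\psi=\Gamma'/\Gamma$ is the digamma function, $\psi^{(k)}$ its $k$-th derivative and $\gamma$ Euler's constant; thus $H_n^{(r)}=\sum_{j=1}^n j^{-r}$ for integers $n\ge 0$. Let $O_n^{(r)}=\sum_{j=1}^n (2j-1)^{-r}$, $O_n=O_n^{(1)}$, and let $\binom{u}{v}=\frac{\Gamma(u+1)}{\Gamma(v+1)\Gamma(u-v+1)}$. If $z\in\mathbb C\setminus\{-1,-2,-3,\dots\}$ and $\Re(z)>-3$, then the following series converges and $$\sum_{n=1}^\infty \frac{(H_{n+z}-H_z)^2+H_{n+z}^{(2)}-H_z^{(2)}}{n(n+1)(n+2)(n+3)\binom{n+z}{z}} =\tfrac12(z+1)\left(H_z^{(2)}-\zeta(2)\right)-\left(z(z+2)+\tfrac23\right)\left(H_z^{(3)}-\zeta(3)\right)+\tfrac12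 z(z+1)(z+2)\left(H_z^{(4)}-\zeta(4)\right)+\tfrac16 .$$ In particular, $$\sum_{n=1}^\infty \frac{H_n^2+H_n^{(2)}}{n(n+1)(n+2)(n+3)}=\tfrac23\zeta(3)-\frac{\pi^2}{12}+\tfrac16,$$ $$\sum_{n=1}^\infty \frac{2^{2n}\left(O_n^2+O_n^{(2)}\right)}{n(n+1)(n+2)(n+3)\binom{2n}{n}}=\frac{\pi^4}{128}-\frac{\pi^2}{32}-\frac{7}{48}\zeta(3)+\frac1{24}.$$ -/

import Mathlib

/-- The generalized binomial coefficient `Γ(u+1) / (Γ(v+1) Γ(u-v+1))` of complex numbers. -/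
noncomputable def complexBinom (u v : ℂ) : ℂ :=
  Complex.Gamma (u + 1) / (Complex.Gamma (v + 1) * Complex.Gamma (u - v + 1))

/-- The harmonic number `H_z^{(r)}` of order `r` at a complex argument `z`. Order one is
`ψ(z+1) + γ`; order `r ≥ 2` is `ζ(r) + (-1)^(r-1) / (r-1)! * ψ^{(r-1)}(z+1)`, where `ψ` is the
digamma function and `ψ^{(k)}` its `k`-th derivative. (Order zero is `z`.) -/
noncomputable def complexHarmonic : ℕ → ℂ → ℂ
  | 0, z => z
  | 1, z => Complex.digamma (z + 1) + (Real.eulerMascheroniConstant : ℂ)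
  | (k + 2), z => riemannZeta ((k + 2 : ℕ) : ℂ) +
      (-1) ^ (k + 1) / ((k + 1).factorial : ℂ) * iteratedDeriv (k + 1) Complex.digamma (z + 1)

/-- The harmonic number `∑_{j=1}^n 1 / j^r` at a natural argument. -/
noncomputable def finiteHarmonic (r n : ℕ) : ℂ :=
  ∑ j ∈ Finset.Icc 1 n, 1 / (j : ℂ) ^ r

/-- The odd harmonic number `O_n^{(r)} = ∑_{j=1}^n 1 / (2j-1)^r`. -/
noncomputable def oddHarmonic (r n : ℕ) : ℂ :=
  ∑ j ∈ Finset.Icc 1 n, 1 / (2 * (j : ℂ) - 1) ^ r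

/-!
The summand is a second derivative in `z`. With `b_n(z) = ∏_{j=1}^n j / (z + j)`, the reciprocal of
the binomial coefficient, one has `b_n'' = b_n * (p_1 ^ 2 + p_2)` where `p_r = ∑_{j=1}^n 1/(z+j)^r`,
and `p_1 = H_{n+z} - H_z`, `p_2 = H_{n+z}^{(2)} - H_z^{(2)}`. So the series is `F''` for
`F(z) = ∑ b_n(z) / (n(n+1)(n+2)(n+3))`, and the theorem follows by differentiating the closed form
(`tsum_baseTerm_eq`)

  `F(z) = -z(z+1)(z+2) S_2(z) / 12 + z^2 / 12 + 5z / 24 + 1 / 18`,  `S_r(z) = ∑_{j ≥ 1} 1/(z+j)^r`,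

twice, since `S_r' = -r S_{r+1}` and `H_z^{(r)} - ζ(r) = -S_r(z)`.

*The closed form.* The terms of `F` satisfy a relation that telescopes in `n`
(`baseTerm_recurrence`) and sums to `(z + 3) F(z) - z F(z + 1) = 1 / (6(z + 1))`
(`tsum_baseTerm_recurrence`). The right-hand side of the closed form obeys the same relation because
`S_2(z) - S_2(z + 1) = 1 / (z + 1)^2`. The difference of the two sides, divided by `z(z+1)(z+2)`, is
therefore invariant under `z ↦ z + 1`; it tends to `0` along `z + m` because `F` is bounded on the
right half plane, hence it vanishes.

*Differentiation.* `F` is a locally uniformly convergent series of holomorphic functions on the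
region `re z > -3`, `z ≠ -1, -2`: up to locally bounded factors its terms are dominated by those
of a telescoping series (`summable_gaussWeight_div`). Termwise differentiation is then Weierstrass'
theorem (`hasSum_iteratedDeriv_of_tendstoLocallyUniformlyOn`).

*Polygamma values.* `ψ'(z + 1) = S_2(z)` is obtained for `re z > 0` by differentiating twice the
series for `log Γ(z + 1)` given by Euler's limit formula (`Gamma_add_one_eq_exp_tsum`), and for the
other `z` from the functional equation of `ψ`.

The two special cases are `z = 0` and `z = -1/2`, where `S_r` is a multiple of `ζ(r)`.
-/

open Filter Topology Finset

/-! ### Termwise differentiation of series of holomorphic functions -/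

/-- A locally uniformly convergent series of holomorphic functions may be differentiated termwise
any number of times. -/
lemma hasSum_iteratedDeriv_of_tendstoLocallyUniformlyOn {ι : Type*} {U : Set ℂ} (hU : IsOpen U)
    {F : ι → ℂ → ℂ} {f : ℂ → ℂ}
    (h : TendstoLocallyUniformlyOn (fun t w => ∑ i ∈ t, F i w) f atTop U)
    (hF : ∀ i, DifferentiableOn ℂ (F i) U) (k : ℕ) {z : ℂ} (hz : z ∈ U) :
    HasSum (fun i => iteratedDeriv k (F i) z) (iteratedDeriv k f z) := by
  induction k generalizing F f with
  | zero => simpa [HasSum] using h.tendsto_at hz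
  | succ k ih =>
    simp only [iteratedDeriv_succ']
    refine ih ?_ fun i => (hF i).deriv hU
    refine (h.deriv (Eventually.of_forall fun t =>
      DifferentiableOn.fun_sum fun i _ => hF i) hU).congr fun t w hw => ?_
    exact deriv_fun_sum fun i _ => (hF i).differentiableAt (hU.mem_nhds hw)

/-- A local form of the Weierstrass M-test, with bounds for all but finitely many terms. -/
lemma tendstoLocallyUniformlyOn_tsum_of_local_bound {ι : Type*} {U : Set ℂ}
    {F : ι → ℂ → ℂ}
    (h : ∀ z ∈ U, ∃ V ∈ 𝓝 z, ∃ u : ι → ℝ, Summable u ∧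
      ∀ᶠ i in cofinite, ∀ w ∈ V, ‖F i w‖ ≤ u i) :
    TendstoLocallyUniformlyOn (fun t w => ∑ i ∈ t, F i w) (fun w => ∑' i, F i w) atTop U := by
  intro v hv x hx
  obtain ⟨V, hV, u, hu, hb⟩ := h x hx
  exact ⟨V, mem_nhdsWithin_of_mem_nhds hV,
    tendstoUniformlyOn_tsum_of_cofinite_eventually hu hb v hv⟩

lemma eventually_two_mul_le_natCast_add_one (R : ℝ) :
    ∀ᶠ j : ℕ in cofinite, 2 * R ≤ (j : ℝ) + 1 := by
  rw [Nat.cofinite_eq_atTop]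
  filter_upwards [eventually_ge_atTop ⌈2 * R⌉₊] with j hj
  have := (Nat.le_ceil (2 * R)).trans (Nat.cast_le.mpr hj)
  linarith

lemma summable_one_div_succ_sq : Summable fun j : ℕ => 1 / ((j : ℝ) + 1) ^ 2 := by
  have := (summable_nat_add_iff 1).mpr (Real.summable_one_div_nat_pow.mpr one_lt_two)
  simpa using this

lemma exists_nhds_norm_le (z : ℂ) : ∃ V ∈ 𝓝 z, ∀ w ∈ V, ‖w‖ ≤ ‖z‖ + 1 :=
  ⟨_, Metric.ball_mem_nhds z one_pos, fun w hw => by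
    rw [Metric.mem_ball, dist_eq_norm] at hw
    linarith [norm_le_norm_add_norm_sub' w z]⟩

/-! ### The logarithm of the Gamma function and the trigamma series -/

/-- The `j`-th term `s log(1 + 1/(j+1)) - log(1 + s/(j+1))` of Euler's series for `log Γ(s+1)`,
with principal logarithms; it is holomorphic on the right half plane. -/
noncomputable def logGammaTerm (j : ℕ) (s : ℂ) : ℂ :=
  s * Complex.log (1 + 1 / ((j : ℂ) + 1)) - Complex.log (1 + s / ((j : ℂ) + 1))

lemma one_add_div_mem_slitPlane {s : ℂ} (hs : 0 < s.re) (j : ℕ) :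
    1 + s / ((j : ℂ) + 1) ∈ Complex.slitPlane := by
  left
  have : s / ((j : ℂ) + 1) = s / (((j : ℝ) + 1 : ℝ) : ℂ) := by push_cast; rfl
  rw [this, Complex.add_re, Complex.div_ofReal_re, Complex.one_re]
  positivity

lemma hasDerivAt_logGammaTerm {s : ℂ} (hs : 0 < s.re) (j : ℕ) :
    HasDerivAt (logGammaTerm j)
      (Complex.log (1 + 1 / ((j : ℂ) + 1)) - 1 / (s + j + 1)) s := by
  have hj : (j : ℂ) + 1 ≠ 0 := Nat.cast_add_one_ne_zero j
  have hsj : s + j + 1 ≠ 0 := fun h => by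
    have := congrArg Complex.re h
    simp at this
    have : (0 : ℝ) ≤ j := Nat.cast_nonneg j
    linarith
  have h1 := (((hasDerivAt_id s).div_const ((j : ℂ) + 1)).const_add 1).clog
    (one_add_div_mem_slitPlane hs j)
  have h2 := ((hasDerivAt_id s).mul_const (Complex.log (1 + 1 / ((j : ℂ) + 1)))).sub h1
  refine h2.congr_deriv ?_
  have : 1 + s / ((j : ℂ) + 1) = (s + j + 1) / (j + 1) := by field_simp; ring
  simp only [id, one_mul, this]
  field_simp

/-- The linear parts of the two logarithms cancel, so the terms are `O(1 / j ^ 2)` locally uniformly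
in `s`. -/
lemma norm_logGammaTerm_le {s : ℂ} {R : ℝ} (hs : ‖s‖ ≤ R) {j : ℕ} (hR : 1 ≤ R)
    (hj : 2 * R ≤ (j : ℝ) + 1) : ‖logGammaTerm j s‖ ≤ (R + R ^ 2) * (1 / ((j : ℝ) + 1) ^ 2) := by
  set x : ℂ := 1 / ((j : ℂ) + 1) with hx
  have hxn : ‖x‖ = 1 / ((j : ℝ) + 1) := by
    rw [hx, norm_div, norm_one]
    congr 1
    have := Complex.norm_natCast (j + 1)
    push_cast at this
    exact this
  have key (w : ℂ) (hw : ‖w‖ ≤ 1 / 2) : ‖Complex.log (1 + w) - w‖ ≤ ‖w‖ ^ 2 := by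
    refine (Complex.norm_log_one_add_sub_self_le (by linarith)).trans ?_
    have : (1 - ‖w‖)⁻¹ ≤ 2 := by
      rw [inv_le_comm₀ (by linarith) two_pos]; linarith
    nlinarith [sq_nonneg ‖w‖]
  have hj0 : (0 : ℝ) < j + 1 := by positivity
  have hRx : R * ‖x‖ ≤ 1 / 2 := by
    rw [hxn, mul_one_div, div_le_div_iff₀ hj0 two_pos]; linarith
  have hx2 : ‖x‖ ≤ 1 / 2 := by nlinarith [norm_nonneg x]
  have hsx : ‖s * x‖ ≤ R * ‖x‖ := by rw [norm_mul]; gcongr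
  have e : logGammaTerm j s =
      s * (Complex.log (1 + x) - x) - (Complex.log (1 + s * x) - s * x) := by
    rw [logGammaTerm, hx, mul_one_div]; ring
  rw [e]
  calc _ ≤ ‖s‖ * ‖Complex.log (1 + x) - x‖ + ‖Complex.log (1 + s * x) - s * x‖ := by
        rw [← norm_mul]; exact norm_sub_le _ _
    _ ≤ R * ‖x‖ ^ 2 + (R * ‖x‖) ^ 2 := by
        gcongr
        · exact key _ hx2
        · exact (key _ (hsx.trans hRx)).trans (by gcongr)
    _ = _ := by rw [hxn]; field_simp

lemma isOpen_re_pos : IsOpen {s : ℂ | 0 < s.re} :=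
  isOpen_lt continuous_const Complex.continuous_re

lemma differentiableOn_logGammaTerm (j : ℕ) :
    DifferentiableOn ℂ (logGammaTerm j) {s | 0 < s.re} :=
  fun _ hw => (hasDerivAt_logGammaTerm hw j).differentiableAt.differentiableWithinAt

lemma tendstoLocallyUniformlyOn_logGammaTerm :
    TendstoLocallyUniformlyOn (fun t w => ∑ j ∈ t, logGammaTerm j w)
      (fun w => ∑' j, logGammaTerm j w) atTop {s | 0 < s.re} := by
  refine tendstoLocallyUniformlyOn_tsum_of_local_bound fun z _ => ?_
  obtain ⟨V, hV, hb⟩ := exists_nhds_norm_le z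
  refine ⟨V, hV, fun j => (‖z‖ + 1 + (‖z‖ + 1) ^ 2) * (1 / ((j : ℝ) + 1) ^ 2),
    summable_one_div_succ_sq.mul_left _, ?_⟩
  filter_upwards [eventually_two_mul_le_natCast_add_one (‖z‖ + 1)] with j hj w hw
  exact norm_logGammaTerm_le (hb w hw) (by linarith [norm_nonneg z]) hj

lemma hasSum_iteratedDeriv_logGammaTerm (k : ℕ) {s : ℂ} (hs : 0 < s.re) :
    HasSum (fun j => iteratedDeriv k (logGammaTerm j) s)
      (iteratedDeriv k (fun w => ∑' j, logGammaTerm j w) s) :=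
  hasSum_iteratedDeriv_of_tendstoLocallyUniformlyOn isOpen_re_pos
    tendstoLocallyUniformlyOn_logGammaTerm differentiableOn_logGammaTerm k hs

lemma sum_log_one_add_one_div (n : ℕ) :
    ∑ j ∈ range n, Complex.log (1 + 1 / ((j : ℂ) + 1)) = Complex.log ((n + 1 : ℕ) : ℂ) := by
  have h (j : ℕ) : Complex.log (1 + 1 / ((j : ℂ) + 1)) =
      Complex.log ((j + 1 + 1 : ℕ) : ℂ) - Complex.log ((j + 1 : ℕ) : ℂ) := by
    have e : (1 + 1 / ((j : ℂ) + 1)) = ((((j + 1 + 1 : ℕ) : ℝ) / ((j + 1 : ℕ) : ℝ) : ℝ) : ℂ) := by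
      have hj : (j : ℂ) + 1 ≠ 0 := Nat.cast_add_one_ne_zero j
      push_cast; field_simp
    rw [e, ← Complex.ofReal_log (by positivity),
      Real.log_div (by positivity) (by positivity)]
    rw [Complex.ofReal_sub, Complex.natCast_log, Complex.natCast_log]
  simp only [h]
  rw [Finset.sum_range_sub (fun j => Complex.log ((j + 1 : ℕ) : ℂ))]
  simp

lemma exp_sum_logGammaTerm {s : ℂ} (hs : 0 < s.re) (n : ℕ) :
    Complex.exp (∑ j ∈ range n, logGammaTerm j s) =
      s * Complex.GammaSeq s (n + 1) * ((s + (n + 1 : ℕ)) / (n + 1 : ℕ)) := by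
  have hne (j : ℕ) : s + j ≠ 0 := fun h => by
    have := congrArg Complex.re h
    simp at this
    have : (0 : ℝ) ≤ j := Nat.cast_nonneg j
    linarith
  have hprod (n : ℕ) : (∏ j ∈ range n, (1 + s / ((j : ℂ) + 1))) * n.factorial * s =
      ∏ j ∈ range (n + 1), (s + j) := by
    induction n with
    | zero => simp
    | succ n ih =>
      rw [Finset.prod_range_succ (n := n + 1), ← ih, Finset.prod_range_succ, Nat.factorial_succ]
      have hj : (n : ℂ) + 1 ≠ 0 := Nat.cast_add_one_ne_zero n
      push_cast
      field_simp
      ring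
  simp only [logGammaTerm, Finset.sum_sub_distrib, ← Finset.mul_sum, sum_log_one_add_one_div]
  rw [Complex.exp_sub, Complex.exp_sum,
    Finset.prod_congr rfl fun j _ => Complex.exp_log
      (Complex.slitPlane_ne_zero (one_add_div_mem_slitPlane hs j)),
    Complex.GammaSeq, Finset.prod_range_succ (n := n + 1), ← hprod,
    Complex.cpow_def_of_ne_zero (by exact_mod_cast n.succ_ne_zero), mul_comm s (Complex.log _)]
  have h0 : s ≠ 0 := by simpa using hne 0
  have h1 := hne (n + 1)
  have h2 : ((n + 1 : ℕ) : ℂ) ≠ 0 := by exact_mod_cast n.succ_ne_zero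
  have h3 : (n.factorial : ℂ) ≠ 0 := by exact_mod_cast n.factorial_ne_zero
  have h4 : ∏ j ∈ range n, (1 + s / ((j : ℂ) + 1)) ≠ 0 := Finset.prod_ne_zero_iff.mpr
    fun j _ => Complex.slitPlane_ne_zero (one_add_div_mem_slitPlane hs j)
  rw [Nat.factorial_succ, Nat.cast_mul]
  generalize ∏ j ∈ range n, (1 + s / ((j : ℂ) + 1)) = Q at h4 ⊢
  field_simp

/-- Euler's limit formula for `Γ(s + 1)`, written as the exponential of a series. -/
lemma Gamma_add_one_eq_exp_tsum {s : ℂ} (hs : 0 < s.re) :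
    Complex.Gamma (s + 1) = Complex.exp (∑' j, logGammaTerm j s) := by
  have h0 : s ≠ 0 := by rintro rfl; simp at hs
  have hsum : HasSum (fun j => logGammaTerm j s) (∑' j, logGammaTerm j s) := by
    simpa using hasSum_iteratedDeriv_logGammaTerm 0 hs
  have h1 := (Complex.continuous_exp.tendsto _).comp hsum.tendsto_sum_nat
  have h2 : Tendsto (fun n : ℕ => (s + (n + 1 : ℕ)) / ((n + 1 : ℕ) : ℂ)) atTop (𝓝 1) := by
    have : Tendsto (fun n : ℕ => s / ((n + 1 : ℕ) : ℂ) + 1) atTop (𝓝 (0 + 1)) := by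
      refine Tendsto.add_const 1 ?_
      exact (tendsto_const_div_atTop_nhds_zero_nat s).comp (tendsto_add_atTop_nat 1)
    rw [zero_add] at this
    refine this.congr fun n => ?_
    have h2 : ((n + 1 : ℕ) : ℂ) ≠ 0 := by exact_mod_cast n.succ_ne_zero
    field_simp
  have h3 := ((((Complex.GammaSeq_tendsto_Gamma s).comp (tendsto_add_atTop_nat 1)).const_mul
    s).mul h2)
  rw [mul_one, ← Complex.Gamma_add_one s h0] at h3
  refine tendsto_nhds_unique h3 (h1.congr fun n => ?_)
  simpa using exp_sum_logGammaTerm hs n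

/-- The series `∑_{j ≥ 1} 1 / (z + j) ^ r`, indexed from `j = 0`; it is the Hurwitz zeta value
`ζ(r, z + 1)`, and equals `ζ(r)` minus the harmonic number of order `r` at `z`. -/
noncomputable def shiftedZeta (r : ℕ) (z : ℂ) : ℂ := ∑' j : ℕ, 1 / (z + j + 1) ^ r

lemma deriv_digamma_add_one_of_re_pos {s : ℂ} (hs : 0 < s.re) :
    deriv Complex.digamma (s + 1) = shiftedZeta 2 s := by
  set L : ℂ → ℂ := fun w => ∑' j, logGammaTerm j w with hL
  have hev : ∀ᶠ w in 𝓝 s, 0 < w.re := isOpen_re_pos.mem_nhds hs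
  have hd (w : ℂ) (hw : 0 < w.re) : DifferentiableAt ℂ L w :=
    (tendstoLocallyUniformlyOn_logGammaTerm.differentiableOn
      (Eventually.of_forall fun t => DifferentiableOn.fun_sum fun j _ =>
        differentiableOn_logGammaTerm j) isOpen_re_pos).differentiableAt
      (isOpen_re_pos.mem_nhds hw)
  have h1 (w : ℂ) (hw : 0 < w.re) : Complex.digamma (w + 1) = deriv L w := by
    have hE : (fun v => Complex.Gamma (v + 1)) =ᶠ[𝓝 w] fun v => Complex.exp (L v) := by
      filter_upwards [isOpen_re_pos.mem_nhds hw] with v hv using Gamma_add_one_eq_exp_tsum hv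
    have := hE.deriv_eq
    rw [deriv_comp_add_const, deriv_cexp (hd w hw)] at this
    rw [Complex.digamma, logDeriv_apply, this, Gamma_add_one_eq_exp_tsum hw]
    exact mul_div_cancel_left₀ _ (Complex.exp_ne_zero _)
  have h2 : deriv Complex.digamma (s + 1) = iteratedDeriv 2 L s := by
    rw [← deriv_comp_add_const, iteratedDeriv_succ, iteratedDeriv_one]
    exact Filter.EventuallyEq.deriv_eq (hev.mono h1)
  rw [h2, ← (hasSum_iteratedDeriv_logGammaTerm 2 hs).tsum_eq, shiftedZeta]
  congr 1 with j
  rw [iteratedDeriv_succ, iteratedDeriv_one]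
  rw [Filter.EventuallyEq.deriv_eq (hev.mono fun w hw => (hasDerivAt_logGammaTerm hw j).deriv)]
  have hsj : s + j + 1 ≠ 0 := fun h => by
    have := congrArg Complex.re h
    simp at this
    have : (0 : ℝ) ≤ j := Nat.cast_nonneg j
    linarith
  have := ((((hasDerivAt_id s).add_const (j : ℂ)).add_const 1).inv hsj).const_sub
    (Complex.log (1 + 1 / ((j : ℂ) + 1)))
  simp only [one_div]
  simp only [one_div] at this
  exact this.deriv.trans (by simp; field_simp)

/-! ### Harmonic numbers at complex arguments -/

/-- The half plane `re z > -3` without its negative integers `-1` and `-2`. -/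
def seriesDomain : Set ℂ := {z | -3 < z.re ∧ z ≠ -1 ∧ z ≠ -2}

lemma isOpen_seriesDomain : IsOpen seriesDomain :=
  (isOpen_lt continuous_const Complex.continuous_re).inter
    (isOpen_ne.inter isOpen_ne)

lemma add_natCast_add_one_ne_zero {z : ℂ} (hz : z ∈ seriesDomain) (j : ℕ) :
    z + j + 1 ≠ 0 := by
  intro h
  have hzj : z = -((j + 1 : ℕ) : ℂ) := by push_cast; linear_combination h
  rcases j with _ | _ | j
  · exact hz.2.1 (by rw [hzj]; norm_num)
  · exact hz.2.2 (by rw [hzj]; norm_num)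
  · have h1 := hz.1
    rw [hzj, Complex.neg_re, Complex.natCast_re] at h1
    push_cast at h1
    have : (0 : ℝ) ≤ j := Nat.cast_nonneg j
    linarith

lemma add_natCast_mem_seriesDomain {z : ℂ} (hz : z ∈ seriesDomain) (m : ℕ) :
    z + m ∈ seriesDomain := by
  refine ⟨?_, fun h => ?_, fun h => ?_⟩
  · have h1 := hz.1
    have : (0 : ℝ) ≤ m := Nat.cast_nonneg m
    rw [Complex.add_re, Complex.natCast_re]; linarith
  · exact add_natCast_add_one_ne_zero hz m (by rw [h]; ring)
  · exact add_natCast_add_one_ne_zero hz (m + 1) (by push_cast; linear_combination h)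

lemma norm_one_div_add_pow_le {w : ℂ} {R : ℝ} (hw : ‖w‖ ≤ R) {j r : ℕ} (hr : 2 ≤ r)
    (hj : 2 * R ≤ (j : ℝ) + 1) :
    ‖1 / (w + j + 1) ^ r‖ ≤ 2 ^ r * (1 / ((j : ℝ) + 1) ^ 2) := by
  have hj0 : (0 : ℝ) < j + 1 := by positivity
  have h1 : ((j : ℝ) + 1) / 2 ≤ ‖w + j + 1‖ := by
    have e : ‖(j : ℂ) + 1‖ = (j : ℝ) + 1 := by
      have := Complex.norm_natCast (j + 1)
      push_cast at this
      exact this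
    have := norm_sub_le (w + j + 1) w
    rw [show w + j + 1 - w = (j : ℂ) + 1 by ring, e] at this
    linarith
  rw [norm_div, norm_one, norm_pow]
  calc 1 / ‖w + j + 1‖ ^ r ≤ 1 / (((j : ℝ) + 1) / 2) ^ r := by gcongr
    _ = 2 ^ r * (1 / ((j : ℝ) + 1) ^ r) := by rw [div_pow]; field_simp
    _ ≤ 2 ^ r * (1 / ((j : ℝ) + 1) ^ 2) := by
      gcongr
      linarith [(Nat.cast_nonneg j : (0 : ℝ) ≤ j)]

lemma tendstoLocallyUniformlyOn_shiftedZeta {r : ℕ} (hr : 2 ≤ r) :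
    TendstoLocallyUniformlyOn (fun (t : Finset ℕ) (w : ℂ) => ∑ j ∈ t, 1 / (w + j + 1) ^ r)
      (shiftedZeta r) atTop seriesDomain := by
  refine tendstoLocallyUniformlyOn_tsum_of_local_bound fun z _ => ?_
  obtain ⟨V, hV, hb⟩ := exists_nhds_norm_le z
  refine ⟨V, hV, fun j => 2 ^ r * (1 / ((j : ℝ) + 1) ^ 2),
    summable_one_div_succ_sq.mul_left _, ?_⟩
  filter_upwards [eventually_two_mul_le_natCast_add_one (‖z‖ + 1)] with j hj w hw
  exact norm_one_div_add_pow_le (hb w hw) hr hj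

lemma hasDerivAt_one_div_add_pow {z : ℂ} (hz : z ∈ seriesDomain) (j r : ℕ) :
    HasDerivAt (fun w : ℂ => 1 / (w + j + 1) ^ r) (-r * (1 / (z + j + 1) ^ (r + 1))) z := by
  have h0 := add_natCast_add_one_ne_zero hz j
  have h := ((((hasDerivAt_id z).add_const (j : ℂ)).add_const 1).pow r).inv (pow_ne_zero r h0)
  simp only [one_div]
  refine h.congr_deriv ?_
  rcases r with _ | r
  · simp
  · simp only [id, Pi.pow_apply, mul_one, Nat.add_sub_cancel]
    field_simp
    ring

lemma hasSum_shiftedZeta {r : ℕ} (hr : 2 ≤ r) {z : ℂ} (hz : z ∈ seriesDomain) :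
    HasSum (fun j : ℕ => 1 / (z + j + 1) ^ r) (shiftedZeta r z) :=
  (tendstoLocallyUniformlyOn_shiftedZeta hr).tendsto_at hz

lemma hasDerivAt_shiftedZeta {r : ℕ} (hr : 2 ≤ r) {z : ℂ} (hz : z ∈ seriesDomain) :
    HasDerivAt (shiftedZeta r) (-r * shiftedZeta (r + 1) z) z := by
  have hd (j : ℕ) : DifferentiableOn ℂ (fun w : ℂ => 1 / (w + j + 1) ^ r) seriesDomain :=
    fun w hw => (hasDerivAt_one_div_add_pow hw j r).differentiableAt.differentiableWithinAt
  have h1 := hasSum_iteratedDeriv_of_tendstoLocallyUniformlyOn isOpen_seriesDomain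
    (tendstoLocallyUniformlyOn_shiftedZeta hr) hd 1 hz
  simp only [iteratedDeriv_one, (hasDerivAt_one_div_add_pow hz _ r).deriv] at h1
  rw [((hasSum_shiftedZeta (by lia : 2 ≤ r + 1) hz).mul_left (-(r : ℂ))).unique h1]
  exact (((tendstoLocallyUniformlyOn_shiftedZeta hr).differentiableOn
    (Eventually.of_forall fun t => DifferentiableOn.fun_sum fun j _ => hd j)
    isOpen_seriesDomain).differentiableAt (isOpen_seriesDomain.mem_nhds hz)).hasDerivAt

lemma shiftedZeta_eq_sum_add {r : ℕ} (hr : 2 ≤ r) {z : ℂ} (hz : z ∈ seriesDomain) (n : ℕ) :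
    shiftedZeta r z = ∑ j ∈ range n, 1 / (z + j + 1) ^ r + shiftedZeta r (z + n) := by
  rw [shiftedZeta, ← (hasSum_shiftedZeta hr hz).summable.sum_add_tsum_nat_add n, shiftedZeta]
  congr 2
  ext j
  push_cast
  ring_nf

lemma tendsto_shiftedZeta_add_natCast {r : ℕ} (hr : 2 ≤ r) {z : ℂ} (hz : z ∈ seriesDomain) :
    Tendsto (fun n : ℕ => shiftedZeta r (z + n)) atTop (𝓝 0) := by
  have h := (hasSum_shiftedZeta hr hz).tendsto_sum_nat.const_sub (shiftedZeta r z)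
  rw [sub_self] at h
  refine h.congr fun n => ?_
  rw [sub_eq_iff_eq_add', ← shiftedZeta_eq_sum_add hr hz]

lemma digamma_add_natCast_add_one {z : ℂ} (hz : z ∈ seriesDomain) (n : ℕ) :
    Complex.digamma (z + n + 1) = Complex.digamma (z + 1) + ∑ j ∈ range n, 1 / (z + j + 1) := by
  induction n with
  | zero => simp
  | succ n ih =>
    have hs (m : ℕ) : z + n + 1 ≠ -m := fun h =>
      add_natCast_add_one_ne_zero hz (n + m) (by push_cast; linear_combination h)
    rw [Finset.sum_range_succ, ← add_assoc, ← ih, one_div, ← Complex.digamma_apply_add_one _ hs]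
    congr 1
    push_cast
    ring

lemma differentiableAt_digamma {s : ℂ} (hs : 0 < s.re) :
    DifferentiableAt ℂ Complex.digamma s := by
  have hne (w : ℂ) (hw : 0 < w.re) (m : ℕ) : w ≠ -m := by
    rintro rfl
    simp only [Complex.neg_re, Complex.natCast_re, Left.neg_pos_iff] at hw
    linarith [(Nat.cast_nonneg m : (0 : ℝ) ≤ m)]
  have hd : DifferentiableOn ℂ Complex.Gamma {s | 0 < s.re} := fun w hw =>
    (Complex.differentiableAt_Gamma w (hne w hw)).differentiableWithinAt
  exact ((hd.deriv isOpen_re_pos).differentiableAt (isOpen_re_pos.mem_nhds hs)).div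
    (Complex.differentiableAt_Gamma s (hne s hs)) (Complex.Gamma_ne_zero (hne s hs))

/-- The trigamma series. Three steps of the functional equation move `z` into the right half
plane. -/
lemma deriv_digamma_add_one {z : ℂ} (hz : z ∈ seriesDomain) :
    deriv Complex.digamma (z + 1) = shiftedZeta 2 z := by
  have h3 : 0 < (z + (3 : ℕ)).re := by
    have := hz.1
    simp; linarith
  have h := deriv_digamma_add_one_of_re_pos h3
  have hev : (fun w => Complex.digamma (w + 1)) =ᶠ[𝓝 z]
      fun w => Complex.digamma (w + 3 + 1) - ∑ j ∈ range 3, 1 / (w + j + 1) := by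
    filter_upwards [isOpen_seriesDomain.mem_nhds hz] with w hw
    have := digamma_add_natCast_add_one hw 3
    push_cast at this
    rw [this]; ring
  have hsum : HasDerivAt (fun w => ∑ j ∈ range 3, 1 / (w + (j : ℂ) + 1))
      (∑ j ∈ range 3, -(1 / (z + j + 1) ^ 2)) z := by
    refine HasDerivAt.fun_sum fun j _ => ?_
    simpa using hasDerivAt_one_div_add_pow hz j 1
  have hdiff : DifferentiableAt ℂ (fun w => Complex.digamma (w + 3 + 1)) z := by
    have hre : 0 < (z + 3 + 1).re := by
      have := hz.1
      simp; linarith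
    exact (differentiableAt_digamma hre).comp z
      ((differentiableAt_id.add_const 3).add_const 1)
  rw [← deriv_comp_add_const, hev.deriv_eq, deriv_fun_sub hdiff hsum.differentiableAt, hsum.deriv,
    shiftedZeta_eq_sum_add le_rfl hz 3, ← h, Finset.sum_neg_distrib, sub_neg_eq_add, add_comm]
  congr 1
  simp only [add_assoc]
  rw [deriv_comp_add_const]
  norm_num

lemma iteratedDeriv_digamma_add_one (k : ℕ) {z : ℂ} (hz : z ∈ seriesDomain) :
    iteratedDeriv (k + 1) Complex.digamma (z + 1) = iteratedDeriv k (shiftedZeta 2) z := by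
  have h : (fun w => deriv Complex.digamma (w + 1)) =ᶠ[𝓝 z] shiftedZeta 2 := by
    filter_upwards [isOpen_seriesDomain.mem_nhds hz] with w hw using deriv_digamma_add_one hw
  rw [iteratedDeriv_succ', ← h.iteratedDeriv_eq k, iteratedDeriv_comp_add_const]

lemma deriv_shiftedZeta_eventuallyEq {r : ℕ} (hr : 2 ≤ r) {z : ℂ} (hz : z ∈ seriesDomain) :
    deriv (shiftedZeta r) =ᶠ[𝓝 z] fun w => -r * shiftedZeta (r + 1) w := by
  filter_upwards [isOpen_seriesDomain.mem_nhds hz] with w hw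
  exact (hasDerivAt_shiftedZeta hr hw).deriv

lemma iteratedDeriv_two_shiftedZeta_two {z : ℂ} (hz : z ∈ seriesDomain) :
    iteratedDeriv 2 (shiftedZeta 2) z = 6 * shiftedZeta 4 z := by
  rw [iteratedDeriv_succ, iteratedDeriv_one, (deriv_shiftedZeta_eventuallyEq le_rfl hz).deriv_eq,
    ((hasDerivAt_shiftedZeta (by norm_num : 2 ≤ 2 + 1) hz).const_mul _).deriv]
  push_cast
  ring

lemma complexHarmonic_two_sub_zeta {z : ℂ} (hz : z ∈ seriesDomain) :
    complexHarmonic 2 z - riemannZeta 2 = -shiftedZeta 2 z := by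
  rw [complexHarmonic, iteratedDeriv_digamma_add_one 0 hz]
  simp

lemma complexHarmonic_three_sub_zeta {z : ℂ} (hz : z ∈ seriesDomain) :
    complexHarmonic 3 z - riemannZeta 3 = -shiftedZeta 3 z := by
  rw [complexHarmonic, iteratedDeriv_digamma_add_one 1 hz, iteratedDeriv_one,
    (hasDerivAt_shiftedZeta le_rfl hz).deriv]
  norm_num [Nat.factorial]
  ring

lemma complexHarmonic_four_sub_zeta {z : ℂ} (hz : z ∈ seriesDomain) :
    complexHarmonic 4 z - riemannZeta 4 = -shiftedZeta 4 z := by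
  rw [complexHarmonic, iteratedDeriv_digamma_add_one 2 hz, iteratedDeriv_two_shiftedZeta_two hz]
  norm_num [Nat.factorial]
  ring

lemma complexHarmonic_one_add_natCast_sub {z : ℂ} (hz : z ∈ seriesDomain) (n : ℕ) :
    complexHarmonic 1 (n + z) - complexHarmonic 1 z = ∑ j ∈ range n, 1 / (z + j + 1) := by
  rw [complexHarmonic, complexHarmonic, add_comm (n : ℂ) z, digamma_add_natCast_add_one hz]
  ring

lemma complexHarmonic_two_add_natCast_sub {z : ℂ} (hz : z ∈ seriesDomain) (n : ℕ) :
    complexHarmonic 2 (n + z) - complexHarmonic 2 z = ∑ j ∈ range n, 1 / (z + j + 1) ^ 2 := by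
  have h1 := complexHarmonic_two_sub_zeta hz
  have h2 := complexHarmonic_two_sub_zeta (add_natCast_mem_seriesDomain hz n)
  rw [add_comm (n : ℂ) z]
  linear_combination h2 - h1 + shiftedZeta_eq_sum_add le_rfl hz n

/-! ### The generating series and its terms -/

/-- The product `∏_{j=1}^n j / (z + j)`, which is the reciprocal of the binomial coefficient
`(n + z)` choose `z`. -/
noncomputable def invBinom (n : ℕ) (z : ℂ) : ℂ := ∏ j ∈ range n, ((j : ℂ) + 1) / (z + j + 1)

/-- The sum `∑_{j=1}^n 1 / (z + j) ^ r`. -/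
noncomputable def shiftedPowerSum (r n : ℕ) (z : ℂ) : ℂ := ∑ j ∈ range n, 1 / (z + j + 1) ^ r

/-- The function of which the summand of index `n + 1` in the theorem is the second derivative. -/
noncomputable def baseTerm (n : ℕ) (z : ℂ) : ℂ :=
  invBinom (n + 1) z / (((n : ℂ) + 1) * (n + 2) * (n + 3) * (n + 4))

lemma invBinom_succ (n : ℕ) (z : ℂ) :
    invBinom (n + 1) z = invBinom n z * (((n : ℂ) + 1) / (z + n + 1)) :=
  Finset.prod_range_succ _ _

lemma hasDerivAt_shiftedPowerSum {z : ℂ} (hz : z ∈ seriesDomain) (r n : ℕ) :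
    HasDerivAt (shiftedPowerSum r n) (-r * shiftedPowerSum (r + 1) n z) z := by
  rw [shiftedPowerSum, Finset.mul_sum]
  exact HasDerivAt.fun_sum fun j _ => hasDerivAt_one_div_add_pow hz j r

lemma hasDerivAt_invBinom {z : ℂ} (hz : z ∈ seriesDomain) (n : ℕ) :
    HasDerivAt (invBinom n) (-invBinom n z * shiftedPowerSum 1 n z) z := by
  induction n with
  | zero =>
    have e : invBinom 0 = fun _ => 1 := by ext w; simp [invBinom]
    rw [e]
    exact (hasDerivAt_const z (1 : ℂ)).congr_deriv (by simp [shiftedPowerSum])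
  | succ n ih =>
    have h1 := (hasDerivAt_one_div_add_pow hz n 1).const_mul ((n : ℂ) + 1)
    have h := ih.mul h1
    have e : invBinom (n + 1) =
        invBinom n * fun w : ℂ => ((n : ℂ) + 1) * (1 / (w + n + 1) ^ 1) := by
      ext w
      rw [invBinom_succ, Pi.mul_apply, pow_one, mul_one_div]
    rw [e]
    refine h.congr_deriv ?_
    have h0 := add_natCast_add_one_ne_zero hz n
    rw [Pi.mul_apply, shiftedPowerSum, shiftedPowerSum, Finset.sum_range_succ]
    push_cast
    field_simp
    ring

lemma iteratedDeriv_two_invBinom {z : ℂ} (hz : z ∈ seriesDomain) (n : ℕ) :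
    iteratedDeriv 2 (invBinom n) z =
      invBinom n z * (shiftedPowerSum 1 n z ^ 2 + shiftedPowerSum 2 n z) := by
  have h : deriv (invBinom n) =ᶠ[𝓝 z] fun w => -invBinom n w * shiftedPowerSum 1 n w := by
    filter_upwards [isOpen_seriesDomain.mem_nhds hz] with w hw using (hasDerivAt_invBinom hw n).deriv
  rw [iteratedDeriv_succ, iteratedDeriv_one, h.deriv_eq]
  have := ((hasDerivAt_invBinom hz n).neg.mul (hasDerivAt_shiftedPowerSum hz 1 n)).deriv
  refine this.trans ?_
  simp only [Pi.neg_apply]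
  push_cast
  ring

lemma iteratedDeriv_two_baseTerm {z : ℂ} (hz : z ∈ seriesDomain) (n : ℕ) :
    iteratedDeriv 2 (baseTerm n) z =
      baseTerm n z * (shiftedPowerSum 1 (n + 1) z ^ 2 + shiftedPowerSum 2 (n + 1) z) := by
  have e : baseTerm n = fun w => (((n : ℂ) + 1) * (n + 2) * (n + 3) * (n + 4))⁻¹ *
      invBinom (n + 1) w := by
    ext w; rw [baseTerm, div_eq_inv_mul]
  rw [e, iteratedDeriv_const_mul_field, iteratedDeriv_two_invBinom hz]
  ring

lemma differentiableOn_baseTerm (n : ℕ) : DifferentiableOn ℂ (baseTerm n) seriesDomain :=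
  fun _ hw => ((hasDerivAt_invBinom hw (n + 1)).div_const _).differentiableAt.differentiableWithinAt

/-! ### Convergence of the generating series -/

/-- The product `∏_{j=1}^n j / (s + j)` for real `s`; it decays like `n ^ (-s)`. -/
noncomputable def gaussWeight (s : ℝ) (n : ℕ) : ℝ := ∏ j ∈ range n, ((j : ℝ) + 1) / (s + j + 1)

lemma gaussWeight_succ (s : ℝ) (n : ℕ) :
    gaussWeight s (n + 1) = gaussWeight s n * (((n : ℝ) + 1) / (s + n + 1)) :=
  Finset.prod_range_succ _ _

lemma gaussWeight_pos {s : ℝ} (hs : 0 < s) (n : ℕ) : 0 < gaussWeight s n :=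
  Finset.prod_pos fun _ _ => by positivity

lemma gaussWeight_sub_succ {s : ℝ} (hs : 0 < s) (n : ℕ) :
    gaussWeight s n - gaussWeight s (n + 1) = s * (gaussWeight s n / (s + n + 1)) := by
  rw [gaussWeight_succ]
  have : s + n + 1 ≠ 0 := by positivity
  field_simp
  ring

/-- The terms are, up to the factor `s`, the successive differences of the positive decreasing
sequence `gaussWeight s`. -/
lemma summable_gaussWeight_div {s : ℝ} (hs : 0 < s) :
    Summable fun n : ℕ => gaussWeight s n / (s + n + 1) := by
  have h : Summable fun n : ℕ => s * (gaussWeight s n / (s + n + 1)) := by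
    refine summable_of_sum_range_le (c := gaussWeight s 0)
      (fun n => by have := gaussWeight_pos hs n; positivity) fun n => ?_
    simp only [← gaussWeight_sub_succ hs]
    rw [Finset.sum_range_sub']
    linarith [gaussWeight_pos hs n]
  simpa [hs.ne'] using h.mul_left s⁻¹

/-- A positive limit would make `∑ 1 / (s + n + 1)` converge. -/
lemma tendsto_gaussWeight {s : ℝ} (hs : 0 < s) :
    Tendsto (gaussWeight s) atTop (𝓝 0) := by
  have hanti : Antitone (gaussWeight s) := antitone_nat_of_succ_le fun n => by
    have := gaussWeight_pos hs n
    have h : 0 ≤ s * (gaussWeight s n / (s + n + 1)) := by positivity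
    rw [← gaussWeight_sub_succ hs] at h
    linarith
  have hbdd : BddBelow (Set.range (gaussWeight s)) :=
    ⟨0, by rintro _ ⟨n, rfl⟩; exact (gaussWeight_pos hs n).le⟩
  have hlim := tendsto_atTop_ciInf hanti hbdd
  set l := ⨅ n, gaussWeight s n
  have hl0 : 0 ≤ l := le_ciInf fun n => (gaussWeight_pos hs n).le
  rcases hl0.eq_or_lt with h | h
  · rwa [← h] at hlim
  · exfalso
    obtain ⟨N, hN⟩ := exists_nat_ge s
    have hsum : Summable fun n : ℕ => l * (1 / ((n + (N + 1) : ℕ) : ℝ)) := by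
      refine Summable.of_nonneg_of_le (fun n => by positivity) (fun n => ?_)
        (summable_gaussWeight_div hs)
      rw [mul_one_div]
      have h1 : l ≤ gaussWeight s n := ciInf_le hbdd n
      have := gaussWeight_pos hs n
      gcongr
      push_cast
      linarith
    rw [summable_mul_left_iff h.ne'] at hsum
    exact Real.not_summable_one_div_natCast ((summable_nat_add_iff (N + 1)).mp hsum)

/-- For `j ≥ 2` the factor `(j + 1) / (w + j + 1)` is at most `(j + 1) / (s + j - 2)` in norm; the
first two factors, which are singular at `-1` and `-2`, are bounded by `C`. -/
lemma norm_invBinom_add_two_le {s C : ℝ} (hs : 0 < s) {w : ℂ} (hw : s ≤ w.re + 3)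
    (hC : ‖invBinom 2 w‖ ≤ C) (n : ℕ) :
    ‖invBinom (n + 2) w‖ ≤
      C * (((n : ℝ) + 1) * (n + 2) * (s + n) / (2 * s) * gaussWeight s n) := by
  induction n with
  | zero =>
    refine hC.trans (le_of_eq ?_)
    simp [gaussWeight]
    field_simp
  | succ n ih =>
    rw [show n + 1 + 2 = (n + 2) + 1 by ring, invBinom_succ, norm_mul, norm_div]
    have h1 : ‖((n + 2 : ℕ) : ℂ) + 1‖ = (n : ℝ) + 3 := by
      have := Complex.norm_natCast (n + 3)
      push_cast at this ⊢
      rw [← this]; ring_nf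
    have h2 : s + n ≤ ‖w + ((n + 2 : ℕ) : ℂ) + 1‖ := by
      refine le_trans ?_ (Complex.re_le_norm _)
      simp
      linarith
    have hC0 : 0 ≤ C := (norm_nonneg _).trans hC
    have hg := gaussWeight_pos hs n
    calc _ ≤ C * (((n : ℝ) + 1) * (n + 2) * (s + n) / (2 * s) * gaussWeight s n) *
          (((n : ℝ) + 3) / (s + n)) := by rw [h1]; gcongr
      _ = _ := by
        rw [gaussWeight_succ]
        have : s + n + 1 ≠ 0 := by positivity
        have : s + n ≠ 0 := by positivity
        push_cast
        field_simp
        ring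

lemma norm_baseTerm_succ (n : ℕ) (w : ℂ) : ‖baseTerm (n + 1) w‖ =
    ‖invBinom (n + 2) w‖ / (((n : ℝ) + 2) * (n + 3) * (n + 4) * (n + 5)) := by
  have h : (((n + 1 : ℕ) : ℂ) + 1) * ((n + 1 : ℕ) + 2) * ((n + 1 : ℕ) + 3) * ((n + 1 : ℕ) + 4) =
      ((((n : ℝ) + 2) * (n + 3) * (n + 4) * (n + 5) : ℝ) : ℂ) := by push_cast; ring
  rw [baseTerm, h, norm_div, Complex.norm_real, Real.norm_of_nonneg (by positivity)]

lemma norm_baseTerm_succ_le {s C : ℝ} (hs : 0 < s) (hs1 : s ≤ 1) {w : ℂ} (hw : s ≤ w.re + 3)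
    (hC : ‖invBinom 2 w‖ ≤ C) (n : ℕ) :
    ‖baseTerm (n + 1) w‖ ≤ C / (2 * s) * (gaussWeight s n / (s + n + 1)) := by
  have hC0 : 0 ≤ C := (norm_nonneg _).trans hC
  have hg := gaussWeight_pos hs n
  rw [norm_baseTerm_succ, div_le_iff₀ (by positivity)]
  refine (norm_invBinom_add_two_le hs hw hC n).trans ?_
  have e : C * (((n : ℝ) + 1) * (n + 2) * (s + n) / (2 * s) * gaussWeight s n) =
      C / (2 * s) * (gaussWeight s n / (s + n + 1)) *
        ((n + 2) * ((n + 1) * (s + n) * (s + n + 1))) := by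
    have : s + n + 1 ≠ 0 := by positivity
    field_simp
  rw [e]
  have hk : ((n : ℝ) + 1) * (s + n) * (s + n + 1) ≤ (n + 3) * (n + 4) * (n + 5) := by
    refine mul_le_mul (mul_le_mul ?_ ?_ ?_ ?_) ?_ ?_ ?_ <;> first | positivity | linarith
  have := mul_le_mul_of_nonneg_left hk (by positivity : (0 : ℝ) ≤ n + 2)
  refine mul_le_mul_of_nonneg_left (by linarith) (by positivity)

/-- Near each point of the domain the hypotheses of `norm_baseTerm_succ_le` hold uniformly. -/
lemma exists_local_baseTerm_bound {z : ℂ} (hz : z ∈ seriesDomain) :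
    ∃ s C : ℝ, 0 < s ∧ s ≤ 1 ∧ ∀ᶠ w in 𝓝 z, s ≤ w.re + 3 ∧ ‖invBinom 2 w‖ ≤ C := by
  have h3 : 0 < z.re + 3 := by linarith [hz.1]
  refine ⟨min 1 ((z.re + 3) / 2), ‖invBinom 2 z‖ + 1, by positivity, min_le_left _ _, ?_⟩
  have h1 : ∀ᶠ w : ℂ in 𝓝 z, (z.re + 3) / 2 < w.re + 3 :=
    (Complex.continuous_re.add continuous_const).continuousAt.eventually_const_lt
      (by simp; linarith)
  have h2 : ∀ᶠ w : ℂ in 𝓝 z, ‖invBinom 2 w‖ < ‖invBinom 2 z‖ + 1 :=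
    (hasDerivAt_invBinom hz 2).continuousAt.norm.eventually_lt_const (by simp)
  filter_upwards [h1, h2] with w hw1 hw2
  exact ⟨(min_le_right _ _).trans hw1.le, hw2.le⟩

lemma tendstoLocallyUniformlyOn_baseTerm :
    TendstoLocallyUniformlyOn (fun t w => ∑ n ∈ t, baseTerm n w)
      (fun w => ∑' n, baseTerm n w) atTop seriesDomain := by
  refine tendstoLocallyUniformlyOn_tsum_of_local_bound fun z hz => ?_
  obtain ⟨s, C, hs, hs1, hb⟩ := exists_local_baseTerm_bound hz
  refine ⟨_, hb, fun n => C / (2 * s) * (gaussWeight s (n - 1) / (s + (n - 1 : ℕ) + 1)), ?_, ?_⟩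
  · refine (summable_nat_add_iff 1).mp ?_
    simpa using (summable_gaussWeight_div hs).mul_left (C / (2 * s))
  · rw [Nat.cofinite_eq_atTop]
    filter_upwards [eventually_ge_atTop 1] with n hn w hw
    obtain ⟨n, rfl⟩ := Nat.exists_eq_add_of_le' hn
    exact norm_baseTerm_succ_le hs hs1 hw.1 hw.2 n

lemma hasSum_baseTerm {z : ℂ} (hz : z ∈ seriesDomain) :
    HasSum (fun n => baseTerm n z) (∑' n, baseTerm n z) :=
  tendstoLocallyUniformlyOn_baseTerm.tendsto_at hz

lemma hasSum_iteratedDeriv_baseTerm (k : ℕ) {z : ℂ} (hz : z ∈ seriesDomain) :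
    HasSum (fun n => iteratedDeriv k (baseTerm n) z)
      (iteratedDeriv k (fun w => ∑' n, baseTerm n w) z) :=
  hasSum_iteratedDeriv_of_tendstoLocallyUniformlyOn isOpen_seriesDomain
    tendstoLocallyUniformlyOn_baseTerm differentiableOn_baseTerm k hz

lemma tendsto_add_four_mul_baseTerm {z : ℂ} (hz : z ∈ seriesDomain) :
    Tendsto (fun n : ℕ => ((n : ℂ) + 4) * baseTerm n z) atTop (𝓝 0) := by
  obtain ⟨s, C, hs, hs1, hb⟩ := exists_local_baseTerm_bound hz
  obtain ⟨hw, hC⟩ := hb.self_of_nhds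
  have hC0 : 0 ≤ C := (norm_nonneg _).trans hC
  rw [← tendsto_add_atTop_iff_nat 1]
  have hlim := (tendsto_gaussWeight hs).const_mul (C / (2 * s))
  rw [mul_zero] at hlim
  refine squeeze_zero_norm (fun n => ?_) hlim
  have h5 : ‖((n + 1 : ℕ) : ℂ) + 4‖ = (n : ℝ) + 5 := by
    have := Complex.norm_natCast (n + 5)
    push_cast at this ⊢
    rw [← this]; ring_nf
  have hg := gaussWeight_pos hs n
  rw [norm_mul, h5, norm_baseTerm_succ]
  calc _ ≤ ((n : ℝ) + 5) * (C * (((n : ℝ) + 1) * (n + 2) * (s + n) / (2 * s) * gaussWeight s n) /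
        (((n : ℝ) + 2) * (n + 3) * (n + 4) * (n + 5))) := by
        gcongr
        exact norm_invBinom_add_two_le hs hw hC n
    _ = C / (2 * s) * gaussWeight s n * (((n + 1) * (s + n)) / ((n + 3) * (n + 4))) := by
        field_simp
    _ ≤ C / (2 * s) * gaussWeight s n * 1 := by
        gcongr
        rw [div_le_one (by positivity)]
        refine mul_le_mul ?_ ?_ ?_ ?_ <;> first | positivity | linarith
    _ = _ := mul_one _

/-! ### The closed form of the generating series -/

lemma invBinom_add_one {z : ℂ} (hz : z ∈ seriesDomain) (n : ℕ) :
    invBinom n (z + 1) = invBinom n z * ((z + 1) / (z + n + 1)) := by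
  have h1 : z + 1 ≠ 0 := by simpa using add_natCast_add_one_ne_zero hz 0
  induction n with
  | zero => simp [invBinom, h1]
  | succ n ih =>
    have h2 := add_natCast_add_one_ne_zero hz n
    have h3 := add_natCast_add_one_ne_zero hz (n + 1)
    rw [invBinom_succ, ih, invBinom_succ]
    push_cast at h3 ⊢
    have h4 : z + 1 + n + 1 ≠ 0 := by convert h3 using 1; ring
    field_simp
    ring

/-- The identity of Wilf–Zeilberger type behind the closed form: this combination of the terms at
`z` and `z + 1` telescopes in `n`. -/
lemma baseTerm_recurrence {z : ℂ} (hz : z ∈ seriesDomain) (n : ℕ) :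
    (z + 3) * baseTerm n z - z * baseTerm n (z + 1) =
      ((n : ℂ) + 4) * baseTerm n z - (((n + 1 : ℕ) : ℂ) + 4) * baseTerm (n + 1) z := by
  have h3 := add_natCast_add_one_ne_zero hz (n + 1)
  rw [baseTerm, baseTerm, baseTerm, invBinom_add_one hz, invBinom_succ (n + 1)]
  have k (m : ℕ) : (n : ℂ) + (m + 1 : ℕ) ≠ 0 := by exact_mod_cast (n + m).succ_ne_zero
  have k1 := k 0
  have k2 := k 1
  have k3 := k 2
  have k4 := k 3
  have k5 := k 4
  push_cast at h3 k1 k2 k3 k4 k5 ⊢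
  norm_num at k1 k2 k3 k4 k5
  norm_num [add_assoc] at h3 k1 k2 k3 k4 k5 ⊢
  field_simp
  ring

lemma tsum_baseTerm_recurrence {z : ℂ} (hz : z ∈ seriesDomain) :
    (z + 3) * ∑' n, baseTerm n z - z * ∑' n, baseTerm n (z + 1) = 1 / (6 * (z + 1)) := by
  have hz1 : z + 1 ∈ seriesDomain := by simpa using add_natCast_mem_seriesDomain hz 1
  have h1 := (((hasSum_baseTerm hz).mul_left (z + 3)).sub
    ((hasSum_baseTerm hz1).mul_left z)).tendsto_sum_nat
  simp only [baseTerm_recurrence hz] at h1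
  have h2 : Tendsto (fun N : ℕ => ((0 : ℕ) + 4) * baseTerm 0 z - ((N : ℂ) + 4) * baseTerm N z)
      atTop (𝓝 (((0 : ℕ) + 4) * baseTerm 0 z - 0)) :=
    (tendsto_add_four_mul_baseTerm hz).const_sub _
  have h := tendsto_nhds_unique h1 (h2.congr fun N => by
    rw [Finset.sum_range_sub' (fun n : ℕ => ((n : ℂ) + 4) * baseTerm n z)])
  rw [h, baseTerm, invBinom]
  have h0 : z + 1 ≠ 0 := by simpa using add_natCast_add_one_ne_zero hz 0
  simp
  field_simp
  norm_num

/-- On the right half plane all factors of `invBinom n w` have norm at most `1`. -/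
lemma norm_tsum_baseTerm_le {w : ℂ} (hw : 0 ≤ w.re) :
    ‖∑' n, baseTerm n w‖ ≤ ∑' n : ℕ, 1 / ((n : ℝ) + 1) ^ 2 := by
  have h1 (n : ℕ) : ‖invBinom n w‖ ≤ 1 := by
    rw [invBinom, norm_prod]
    refine Finset.prod_le_one (fun _ _ => norm_nonneg _) fun j _ => ?_
    rw [norm_div]
    refine div_le_one_of_le₀ ?_ (norm_nonneg _)
    have := Complex.norm_natCast (j + 1)
    push_cast at this
    rw [this]
    refine le_trans ?_ (Complex.re_le_norm _)
    simp [hw]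
  refine tsum_of_norm_bounded summable_one_div_succ_sq.hasSum fun n => ?_
  have h : (((n : ℂ) + 1) * (n + 2) * (n + 3) * (n + 4)) =
      ((((n : ℝ) + 1) * (n + 2) * (n + 3) * (n + 4) : ℝ) : ℂ) := by push_cast; ring
  rw [baseTerm, h, norm_div, Complex.norm_real, Real.norm_of_nonneg (by positivity)]
  have hn : (0 : ℝ) ≤ n := Nat.cast_nonneg n
  refine div_le_div₀ zero_le_one (h1 _) (by positivity) ?_
  nlinarith [mul_nonneg hn hn, mul_nonneg (mul_nonneg hn hn) hn,
    mul_nonneg (mul_nonneg hn hn) (mul_nonneg hn hn)]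

lemma tendsto_inv_add_natCast (z : ℂ) : Tendsto (fun n : ℕ => (z + n)⁻¹) atTop (𝓝 0) := by
  refine tendsto_inv₀_cobounded.comp (tendsto_norm_atTop_iff_cobounded.mp ?_)
  refine tendsto_atTop_mono (fun n : ℕ => ?_)
    (tendsto_atTop_add_const_left _ (-‖z‖) tendsto_natCast_atTop_atTop)
  have := norm_sub_le (z + n) z
  rw [add_sub_cancel_left, Complex.norm_natCast] at this
  linarith

/-- The closed form. The point `z = 0`, where `z(z+1)(z+2)` vanishes, is read off from the
recurrence directly. -/
lemma tsum_baseTerm_eq {z : ℂ} (hz : z ∈ seriesDomain) :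
    ∑' n, baseTerm n z = -(z * (z + 1) * (z + 2)) * shiftedZeta 2 z / 12 +
      (z ^ 2 / 12 + 5 * z / 24 + 1 / 18) := by
  rcases eq_or_ne z 0 with rfl | hz0
  · have := tsum_baseTerm_recurrence hz
    norm_num at this ⊢
    linear_combination this / 3
  -- `E m` is the difference of the two sides at `x = z + m`, divided by `x(x+1)(x+2)`; the
  -- polynomial `x²/12 + 5x/24 + 1/18` is expanded as `(x+1)(x+2)/12 - (x+1)/24 - 5/72`.
  set E : ℕ → ℂ := fun m => (∑' n, baseTerm n (z + m)) * (z + m)⁻¹ * (z + 1 + m)⁻¹ *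
    (z + 2 + m)⁻¹ + shiftedZeta 2 (z + m) / 12 - (1 / 12 * (z + m)⁻¹ -
      1 / 24 * ((z + m)⁻¹ * (z + 2 + m)⁻¹) -
      5 / 72 * ((z + m)⁻¹ * (z + 1 + m)⁻¹ * (z + 2 + m)⁻¹)) with hE
  have hne (m : ℕ) : z + m ≠ 0 := by
    rcases m with _ | m
    · simpa using hz0
    · convert add_natCast_add_one_ne_zero hz m using 1
      push_cast; ring
  have hne1 (m : ℕ) : z + 1 + m ≠ 0 := by
    convert hne (m + 1) using 1
    push_cast; ring
  have hne2 (m : ℕ) : z + 2 + m ≠ 0 := by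
    convert hne (m + 2) using 1
    push_cast; ring
  have hstep (m : ℕ) : E (m + 1) = E m := by
    have hm := add_natCast_mem_seriesDomain hz m
    have hr := tsum_baseTerm_recurrence hm
    have hs := shiftedZeta_eq_sum_add le_rfl hm 1
    simp only [Finset.sum_range_one, Nat.cast_zero, add_zero, Nat.cast_one] at hs
    have a0 := hne m
    have a1 := hne1 m
    have a2 := hne2 m
    have a3 : z + 3 + m ≠ 0 := by
      convert hne (m + 3) using 1
      push_cast; ring
    simp only [hE]
    push_cast
    rw [show z + ((m : ℂ) + 1) = z + m + 1 by ring, show z + 1 + ((m : ℂ) + 1) = z + m + 2 by ring,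
      show z + 2 + ((m : ℂ) + 1) = z + m + 3 by ring, hs]
    rw [show z + 1 + (m : ℂ) = z + m + 1 by ring] at a1 ⊢
    rw [show z + 2 + (m : ℂ) = z + m + 2 by ring] at a2 ⊢
    rw [show z + 3 + (m : ℂ) = z + m + 3 by ring] at a3
    generalize z + (m : ℂ) = x at *
    generalize ∑' n, baseTerm n x = F0 at *
    generalize ∑' n, baseTerm n (x + 1) = F1 at *
    generalize shiftedZeta 2 (x + 1) = S at *
    field_simp at hr ⊢
    linear_combination (-3456) * hr
  have hconst (m : ℕ) : E m = E 0 := by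
    induction m with
    | zero => rfl
    | succ m ih => rw [hstep, ih]
  have hlim : Tendsto E atTop (𝓝 0) := by
    have i0 := tendsto_inv_add_natCast z
    have i1 := tendsto_inv_add_natCast (z + 1)
    have i2 := tendsto_inv_add_natCast (z + 2)
    have hF : Tendsto (fun m : ℕ => (∑' n, baseTerm n (z + m)) * (z + m)⁻¹) atTop (𝓝 0) := by
      refine isBoundedUnder_le_mul_tendsto_zero ?_ i0
      refine isBoundedUnder_of_eventually_le (a := ∑' n : ℕ, 1 / ((n : ℝ) + 1) ^ 2) ?_
      filter_upwards [eventually_ge_atTop 3] with m hm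
      refine norm_tsum_baseTerm_le ?_
      have h3 : (3 : ℝ) ≤ m := by exact_mod_cast hm
      have := hz.1
      simp
      linarith
    have := (((hF.mul i1).mul i2).add
      ((tendsto_shiftedZeta_add_natCast le_rfl hz).div_const 12)).sub
      (((i0.const_mul (1 / 12)).sub ((i0.mul i2).const_mul (1 / 24))).sub
        (((i0.mul i1).mul i2).const_mul (5 / 72)))
    simpa [hE] using this
  have h0 : E 0 = 0 :=
    tendsto_nhds_unique (tendsto_const_nhds.congr fun m => (hconst m).symm) hlim
  have a1 := hne1 0
  have a2 := hne2 0
  simp only [hE, Nat.cast_zero, add_zero] at h0 a1 a2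
  field_simp at h0 ⊢
  linear_combination h0 / 4

/-! ### Evaluation of the series -/

lemma iteratedDeriv_two_tsum_baseTerm {z : ℂ} (hz : z ∈ seriesDomain) :
    iteratedDeriv 2 (fun w => ∑' n, baseTerm n w) z =
      -(1 / 2) * (z + 1) * shiftedZeta 2 z + (z * (z + 2) + 2 / 3) * shiftedZeta 3 z -
        1 / 2 * z * (z + 1) * (z + 2) * shiftedZeta 4 z + 1 / 6 := by
  have hd (w : ℂ) (hw : w ∈ seriesDomain) : HasDerivAt (fun w => ∑' n, baseTerm n w)
      ((-(3 * w ^ 2 + 6 * w + 2) * shiftedZeta 2 w +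
        2 * (w ^ 3 + 3 * w ^ 2 + 2 * w) * shiftedZeta 3 w) / 12 + (w / 6 + 5 / 24)) w := by
    have hev : (fun w => ∑' n, baseTerm n w) =ᶠ[𝓝 w] fun w =>
        -(w ^ 3 + 3 * w ^ 2 + 2 * w) * shiftedZeta 2 w / 12 +
          (w ^ 2 / 12 + 5 * w / 24 + 1 / 18) := by
      filter_upwards [isOpen_seriesDomain.mem_nhds hw] with v hv
      rw [tsum_baseTerm_eq hv]
      ring
    refine HasDerivAt.congr_of_eventuallyEq ?_ hev
    have hx := hasDerivAt_id w
    have hP := (((hx.pow 3).add ((hx.pow 2).const_mul 3)).add (hx.const_mul 2)).neg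
    have h := ((hP.mul (hasDerivAt_shiftedZeta le_rfl hw)).div_const 12).add
      ((((hx.pow 2).div_const 12).add ((hx.const_mul 5).div_const 24)).add_const (1 / 18))
    refine h.congr_deriv ?_
    simp
    ring
  have hev : deriv (fun w => ∑' n, baseTerm n w) =ᶠ[𝓝 z] fun w =>
      (-(3 * w ^ 2 + 6 * w + 2) * shiftedZeta 2 w +
        2 * (w ^ 3 + 3 * w ^ 2 + 2 * w) * shiftedZeta 3 w) / 12 + (w / 6 + 5 / 24) := by
    filter_upwards [isOpen_seriesDomain.mem_nhds hz] with w hw using (hd w hw).deriv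
  rw [iteratedDeriv_succ, iteratedDeriv_one, hev.deriv_eq]
  have hx := hasDerivAt_id z
  have hP := ((hx.pow 3).add ((hx.pow 2).const_mul 3)).add (hx.const_mul 2)
  have hQ := ((((hx.pow 2).const_mul 3).add (hx.const_mul 6)).add_const 2).neg
  have h := (((hQ.mul (hasDerivAt_shiftedZeta le_rfl hz)).add
    ((hP.const_mul 2).mul (hasDerivAt_shiftedZeta (by norm_num : 2 ≤ 3) hz))).div_const 12).add
    ((hx.div_const 6).add_const (5 / 24))
  refine h.deriv.trans ?_
  simp
  ring

lemma hasSum_baseTerm_mul_powerSums {z : ℂ} (hz : z ∈ seriesDomain) :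
    HasSum (fun n => baseTerm n z *
        (shiftedPowerSum 1 (n + 1) z ^ 2 + shiftedPowerSum 2 (n + 1) z))
      (-(1 / 2) * (z + 1) * shiftedZeta 2 z + (z * (z + 2) + 2 / 3) * shiftedZeta 3 z -
        1 / 2 * z * (z + 1) * (z + 2) * shiftedZeta 4 z + 1 / 6) := by
  have h := hasSum_iteratedDeriv_baseTerm 2 hz
  simpa only [iteratedDeriv_two_baseTerm hz, iteratedDeriv_two_tsum_baseTerm hz] using h

lemma hasSum_pnat_of_hasSum_nat {f : ℕ+ → ℂ} {g : ℕ → ℂ} {a b : ℂ} (h : HasSum g a)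
    (hfg : ∀ n : ℕ, f n.succPNat = g n) (hab : a = b) : HasSum f b := by
  rw [← Equiv.pnatEquivNat.symm.hasSum_iff, ← hab, show f ∘ Equiv.pnatEquivNat.symm = g from
    funext hfg]
  exact h

lemma complexBinom_mul_invBinom {z : ℂ} (hz : z ∈ seriesDomain) (n : ℕ) :
    complexBinom (n + z) z * invBinom n z = 1 := by
  have hG (m : ℕ) : Complex.Gamma (z + m + 1) ≠ 0 := by
    refine Complex.Gamma_ne_zero fun k h => add_natCast_add_one_ne_zero hz (m + k) ?_
    push_cast
    linear_combination h
  have h : Complex.Gamma (z + n + 1) * invBinom n z = n.factorial * Complex.Gamma (z + 1) := by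
    induction n with
    | zero => simp [invBinom]
    | succ n ih =>
      have h0 := add_natCast_add_one_ne_zero hz n
      rw [show z + (n + 1 : ℕ) + 1 = (z + n + 1) + 1 by push_cast; ring,
        Complex.Gamma_add_one _ h0, invBinom_succ, Nat.factorial_succ]
      push_cast
      field_simp
      linear_combination ih
  have h1 : Complex.Gamma (z + 1) ≠ 0 := by simpa using hG 0
  have h2 : (n.factorial : ℂ) ≠ 0 := by exact_mod_cast n.factorial_ne_zero
  rw [complexBinom, add_sub_cancel_right, Complex.Gamma_nat_eq_factorial, add_comm (n : ℂ) z,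
    div_mul_eq_mul_div, h, mul_comm, div_self (mul_ne_zero h1 h2)]

lemma summable_one_div_natCast_pow {r : ℕ} (hr : 1 < r) :
    Summable fun n : ℕ => 1 / (n : ℂ) ^ r :=
  Summable.of_norm (by simpa using Real.summable_one_div_nat_pow.mpr hr)

lemma shiftedZeta_zero {r : ℕ} (hr : 1 < r) : shiftedZeta r 0 = riemannZeta r := by
  rw [shiftedZeta, zeta_nat_eq_tsum_of_gt_one hr,
    (summable_one_div_natCast_pow hr).tsum_eq_zero_add]
  simp [(zero_lt_one.trans hr).ne']

/-- At `z = -1/2` the series runs over the odd integers, and the even ones contribute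
`ζ(r) / 2 ^ r` to `ζ(r)`. -/
lemma shiftedZeta_neg_half {r : ℕ} (hr : 1 < r) :
    shiftedZeta r (-1 / 2) = (2 ^ r - 1) * riemannZeta r := by
  have hs := summable_one_div_natCast_pow hr
  have h1 := tsum_even_add_odd (f := fun n : ℕ => 1 / (n : ℂ) ^ r)
    (hs.comp_injective fun a b h => by simpa using h)
    (hs.comp_injective fun a b h => by simpa using h)
  have he : ∑' k : ℕ, 1 / ((2 * k : ℕ) : ℂ) ^ r = 1 / 2 ^ r * riemannZeta r := by
    rw [zeta_nat_eq_tsum_of_gt_one hr, ← tsum_mul_left]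
    congr 1 with k
    rw [Nat.cast_mul, mul_pow]
    push_cast
    rw [one_div_mul_one_div]
  have ho : shiftedZeta r (-1 / 2) = 2 ^ r * ∑' k : ℕ, 1 / ((2 * k + 1 : ℕ) : ℂ) ^ r := by
    rw [shiftedZeta, ← tsum_mul_left]
    congr 1 with k
    rw [show (-1 / 2 : ℂ) + k + 1 = (2 * k + 1 : ℕ) / 2 by push_cast; ring, div_pow]
    field_simp
  rw [he, ← zeta_nat_eq_tsum_of_gt_one hr] at h1
  rw [ho, eq_sub_of_add_eq' h1]
  field_simp

lemma zero_mem_seriesDomain : (0 : ℂ) ∈ seriesDomain := by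
  refine ⟨?_, ?_, ?_⟩ <;> norm_num

lemma neg_half_mem_seriesDomain : (-1 / 2 : ℂ) ∈ seriesDomain := by
  have : (-1 / 2 : ℂ) = ((-1 / 2 : ℝ) : ℂ) := by push_cast; rfl
  rw [this]
  refine ⟨?_, fun h => ?_, fun h => ?_⟩
  · rw [Complex.ofReal_re]; norm_num
  all_goals
    have := congrArg Complex.re h
    norm_num at this

lemma finiteHarmonic_eq_shiftedPowerSum (r n : ℕ) : finiteHarmonic r n = shiftedPowerSum r n 0 := by
  rw [finiteHarmonic, shiftedPowerSum, ← Finset.Ico_add_one_right_eq_Icc,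
    Finset.sum_Ico_eq_sum_range]
  simp [add_comm]

lemma shiftedPowerSum_neg_half (r n : ℕ) :
    shiftedPowerSum r n (-1 / 2) = 2 ^ r * oddHarmonic r n := by
  rw [oddHarmonic, shiftedPowerSum, ← Finset.Ico_add_one_right_eq_Icc,
    Finset.sum_Ico_eq_sum_range, Finset.mul_sum]
  refine Finset.sum_congr (by simp) fun j _ => ?_
  rw [show (-1 / 2 : ℂ) + j + 1 = (2 * ((1 + j : ℕ) : ℂ) - 1) / 2 by push_cast; ring, div_pow,
    one_div_div, mul_one_div]

lemma invBinom_zero_right (n : ℕ) : invBinom n 0 = 1 :=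
  Finset.prod_eq_one fun j _ => by
    rw [zero_add]; exact div_self (Nat.cast_add_one_ne_zero j)

lemma invBinom_neg_half (n : ℕ) :
    invBinom n (-1 / 2) = 2 ^ (2 * n) / ((2 * n).choose n : ℂ) := by
  have hc (m : ℕ) : (m.centralBinom : ℂ) ≠ 0 := by exact_mod_cast m.centralBinom_ne_zero
  rw [← Nat.centralBinom_eq_two_mul_choose, eq_div_iff (hc n)]
  induction n with
  | zero => simp [invBinom]
  | succ n ih =>
    have h := congrArg (Nat.cast : ℕ → ℂ) (Nat.succ_mul_centralBinom_succ n)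
    have h2 : (2 * n + 1 : ℂ) ≠ 0 := by exact_mod_cast (2 * n).succ_ne_zero
    push_cast at h
    rw [invBinom_succ, show (-1 / 2 : ℂ) + n + 1 = (2 * n + 1) / 2 by ring,
      show 2 * (n + 1) = 2 * n + 2 by ring, pow_add, ← ih]
    have hn : (n : ℂ) + 1 ≠ 0 := Nat.cast_add_one_ne_zero n
    rw [eq_div_of_mul_eq hn ((mul_comm _ _).trans h)]
    field_simp

theorem theorem17 :
    (∀ z : ℂ, (∀ k : ℕ, 1 ≤ k → z ≠ -(k : ℂ)) → -3 < z.re →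
      HasSum
        (fun n : ℕ+ =>
          ((complexHarmonic 1 ((n : ℂ) + z) - complexHarmonic 1 z) ^ 2
              + complexHarmonic 2 ((n : ℂ) + z) - complexHarmonic 2 z) /
            ((n : ℂ) * ((n : ℂ) + 1) * ((n : ℂ) + 2) * ((n : ℂ) + 3) *
              complexBinom ((n : ℂ) + z) z))
        (1 / 2 * (z + 1) * (complexHarmonic 2 z - riemannZeta 2)
          - (z * (z + 2) + 2 / 3) * (complexHarmonic 3 z - riemannZeta 3)
          + 1 / 2 * z * (z + 1) * (z + 2) * (complexHarmonic 4 z - riemannZeta 4)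
          + 1 / 6)) ∧
    HasSum
      (fun n : ℕ+ =>
        (finiteHarmonic 1 n ^ 2 + finiteHarmonic 2 n) /
          ((n : ℂ) * ((n : ℂ) + 1) * ((n : ℂ) + 2) * ((n : ℂ) + 3)))
      (2 / 3 * riemannZeta 3 - (Real.pi : ℂ) ^ 2 / 12 + 1 / 6) ∧
    HasSum
      (fun n : ℕ+ =>
        (2 : ℂ) ^ (2 * (n : ℕ)) * (oddHarmonic 1 n ^ 2 + oddHarmonic 2 n) /
          ((n : ℂ) * ((n : ℂ) + 1) * ((n : ℂ) + 2) * ((n : ℂ) + 3) *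
            (Nat.choose (2 * (n : ℕ)) (n : ℕ) : ℂ)))
      ((Real.pi : ℂ) ^ 4 / 128 - (Real.pi : ℂ) ^ 2 / 32 - 7 / 48 * riemannZeta 3 + 1 / 24) := by
  have hden (n : ℕ) : ((n.succPNat : ℕ) : ℂ) * ((n.succPNat : ℕ) + 1) * ((n.succPNat : ℕ) + 2) *
      ((n.succPNat : ℕ) + 3) = ((n : ℂ) + 1) * (n + 2) * (n + 3) * (n + 4) := by
    rw [Nat.succPNat_coe]
    push_cast
    ring
  refine ⟨fun z hz hre => ?_, ?_, ?_⟩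
  · have hzU : z ∈ seriesDomain :=
      ⟨hre, by simpa using hz 1 le_rfl, by simpa using hz 2 one_le_two⟩
    have h := hasSum_baseTerm_mul_powerSums hzU
    rw [complexHarmonic_two_sub_zeta hzU, complexHarmonic_three_sub_zeta hzU,
      complexHarmonic_four_sub_zeta hzU]
    refine hasSum_pnat_of_hasSum_nat h (fun n => ?_) (by ring)
    have hB := complexBinom_mul_invBinom hzU (n + 1)
    have hB0 := left_ne_zero_of_mul_eq_one hB
    rw [hden, add_sub_assoc, complexHarmonic_one_add_natCast_sub hzU,
      complexHarmonic_two_add_natCast_sub hzU, baseTerm, Nat.succPNat_coe, Nat.succ_eq_add_one,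
      eq_one_div_of_mul_eq_one_right hB, shiftedPowerSum, shiftedPowerSum]
    simp only [pow_one]
    field_simp
  · have h := hasSum_baseTerm_mul_powerSums zero_mem_seriesDomain
    rw [shiftedZeta_zero one_lt_two, shiftedZeta_zero (by norm_num : 1 < 3)] at h
    push_cast at h
    rw [riemannZeta_two] at h
    refine hasSum_pnat_of_hasSum_nat h (fun n => ?_) (by ring)
    rw [hden, baseTerm, invBinom_zero_right, finiteHarmonic_eq_shiftedPowerSum,
      finiteHarmonic_eq_shiftedPowerSum, Nat.succPNat_coe, Nat.succ_eq_add_one]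
    ring
  -- The power sums at `-1/2` carry a factor `2 ^ 2` compared with the odd harmonic numbers.
  · have h := (hasSum_baseTerm_mul_powerSums neg_half_mem_seriesDomain).div_const 4
    rw [shiftedZeta_neg_half one_lt_two, shiftedZeta_neg_half (by norm_num : 1 < 3),
      shiftedZeta_neg_half (by norm_num : 1 < 4)] at h
    push_cast at h
    rw [riemannZeta_two, riemannZeta_four] at h
    refine hasSum_pnat_of_hasSum_nat h (fun n => ?_) (by ring)
    rw [hden, baseTerm, invBinom_neg_half, shiftedPowerSum_neg_half, shiftedPowerSum_neg_half,
      Nat.succPNat_coe, Nat.succ_eq_add_one]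
    simp only [div_eq_mul_inv, mul_inv]
    ring
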